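/- Let $G=(V,E)$ be a (finite or infinite, undirected, simple) graph of bounded degree, $\rho\in V$ a vertex, and for $r\ge 0$ let $G_r$ be the subgraph of $G$ induced on $V_r=\{v:\operatorname{dist}(\rho,v)\le r\}$. Let $S$ be a finite set of spins and let every edge $\{v,w\}\in E$ carry a weight function $\alpha_{vw}:S\times S\to[0,\infty)$, with $\alpha_{vw}(a,b)=\alpha_{wv}(b,a)$; zero weights (hard constraints) are allowed. Assume that for each $r$ there is a legal configuration on $G_r$, that is, a $\sigma\in S^{V_r}$ with $\prod_{\{v,w\}\in E(G_r)}\alpha_{vw}(\sigma_v,\sigma_w)>0$. The Gibbs distribution $\mu_r$ on $S^{V_r}$ gives each $\sigma$ a probability proportional to this product. The heat-bath Glauber dynamics on $G_r$ is the continuous-time Markov chain on the legal configurations with generator $$(\mathcal L f)(\sigma)=\sum_{v\in V_r}\sum_{a\in S}K[\sigma\to\sigma_v^a]\,\bigl(f(\sigma_v^a)-f(\sigma)\bigr),\qquad K[\sigma\to\sigma_v^a]=\frac{\prod_{w\sim v}\alpha_{vw}(a,\sigma_w)}{\sum_{a'\in S}\prod_{w\sim v}\alpha_{vw}(a',\sigma_w)},$$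 where $\sigma_v^a$ is $\sigma$ with the spin at $v$ replaced by $a$, and $w$ ranges over the neighbours of $v$ in $G_r$. Its relaxation time is $\tau_2(G_r)=1/\lambda_2$, where $0=\lambda_1\le\lambda_2\le\dots$ are the eigenvalues of $-\mathcal L$ with multiplicity ($\tau_2=\infty$ if $\lambda_2=0$, and $\tau_2=0$ if there is only one legal configuration). Suppose that $\tau_2(G_r)=O(1)$ as $r\to\infty$. Let $A\subset V$ be a finite set of vertices, let $\sigma_A$ denote the restriction of $\sigma$ to $A\cap V_r$ (which is $A$ for large $r$ if $G$ is connected), and let $\sigma_r$ denote its restriction to the vertices at distance exactly $r$ from $\rho$. Then: 1. there is $c_A>0$ such that for all sufficiently large $r$, and all real functions $f,g$ on $S^{V_r}$ such that $f(\sigma)$ depends only on $\sigma_A$ and $g(\sigma)$ depends only on $\sigma_r$, $$\operatorname{Cov}_{\mu_r}[f,g]\le e^{-c_A r}\sqrt{\operatorname{Var}_{\mu_r}(f)\operatorname{Var}_{\mu_r}(g)};$$ 2. there is $c_A'>0$ such that for all sufficiently large $r$ the mutual information under $\mu_r$ satisfies $$I[\sigma_A,\sigma_r]\le e^{-c_A'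 r}.$$ -/

import Mathlib

open Filter MeasureTheory ProbabilityTheory
open scoped NNReal ENNReal

/-- Pair interactions between spins in `S` placed on the vertices in `V`: the weight function
`α_{vw} : S × S → ℝ₊` of an undirected edge `{v, w}` is `weight v w`, so that
`α_{vw}(a, b) = α_{wv}(b, a)`. The weights may vanish (hard constraints). On a graph, only the values
at pairs of adjacent vertices are ever used. -/
structure SpinSystem (V S : Type*) where
  weight : V → V → S → S → ℝ≥0
  symm : ∀ v w a b, weight v w a b = weight w v b a

namespace SpinSystem

/-- The same interactions on a subset of the vertices. -/
def restrict {V S : Type*} (α : SpinSystem V S) (U : Set V) : SpinSystem U S where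
  weight v w := α.weight v w
  symm v w := α.symm v w

section FiniteGraph

variable {W S : Type*} [Fintype W] [Fintype S] (α : SpinSystem W S) (H : SimpleGraph W)

open Classical in
/-- The Gibbs weight `∏_{ {v, w} ∈ E } α_{vw}(σ_v, σ_w)` of a configuration (a product over
undirected edges). -/
noncomputable def configWeight (σ : W → S) : ℝ≥0 :=
  ∏ e ∈ H.edgeFinset,
    Sym2.lift ⟨fun v w => α.weight v w (σ v) (σ w), fun v w => α.symm v w (σ v) (σ w)⟩ e

/-- Legal configurations: those of positive Gibbs weight. They are the states of the dynamics. -/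
abbrev Legal : Type _ := {σ : W → S // α.configWeight H σ ≠ 0}

open Classical in
/-- The partition function. -/
noncomputable def partitionFunction : ℝ≥0 := ∑ σ : W → S, α.configWeight H σ

open Classical in
/-- The Gibbs distribution: the configuration `σ` has probability `configWeight σ / Z`. -/
noncomputable def gibbs [MeasurableSpace S] : Measure (W → S) :=
  ∑ σ : W → S,
    ((α.configWeight H σ / α.partitionFunction H : ℝ≥0) : ℝ≥0∞) • Measure.dirac σ

open Classical in
/-- `∏_{w ~ v} α_{vw}(a, σ_w)`. -/
noncomputable def localWeight (σ : W → S) (v : W) (a : S) : ℝ≥0 :=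
  ∏ w ∈ H.neighborFinset v, α.weight v w a (σ w)

/-- The heat-bath rate `K[σ → σ_v^a]`. -/
noncomputable def rate (σ : W → S) (v : W) (a : S) : ℝ :=
  (α.localWeight H σ v a : ℝ) / ∑ a' : S, (α.localWeight H σ v a' : ℝ)

open Classical in
/-- From a legal configuration, only transitions to legal configurations have positive rate. -/
theorem legal_update_of_rate_ne_zero {σ : W → S} (hσ : α.configWeight H σ ≠ 0) {v : W} {a : S}
    (h : α.rate H σ v a ≠ 0) : α.configWeight H (Function.update σ v a) ≠ 0 := by
  have hl : α.localWeight H σ v a ≠ 0 := by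
    intro h0
    exact h (by simp [rate, h0])
  rw [localWeight, Finset.prod_ne_zero_iff] at hl
  rw [configWeight, Finset.prod_ne_zero_iff] at hσ ⊢
  intro e he
  have h1 := hσ e he
  induction e using Sym2.ind with
  | _ x y =>
    have hxy : H.Adj x y := by simpa using he
    simp only [Sym2.lift_mk] at h1 ⊢
    by_cases hx : x = v
    · subst hx
      have hy : y ≠ x := hxy.ne'
      simpa [Function.update_of_ne hy] using hl y (by simpa using hxy)
    · by_cases hy : y = v
      · subst hy
        rw [α.symm]
        simpa [Function.update_of_ne hx] using hl x (by simpa using hxy.symm)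
      · simpa [Function.update_of_ne hx, Function.update_of_ne hy] using h1

open Classical in
/-- The generator of the heat-bath Glauber dynamics,
`(𝓛 f)(σ) = ∑_v ∑_a K[σ → σ_v^a] (f(σ_v^a) - f(σ))`, acting on functions of the legal
configurations. The terms in which `σ_v^a` is not legal have rate `0`. -/
noncomputable def generator :
    (α.Legal H → ℝ) →ₗ[ℝ] (α.Legal H → ℝ) where
  toFun f σ := ∑ v : W, ∑ a : S,
    if h : α.configWeight H (Function.update σ.1 v a) ≠ 0 then
      α.rate H σ.1 v a * (f ⟨Function.update σ.1 v a, h⟩ - f σ)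
    else 0
  map_add' f g := by
    funext σ
    simp only [Pi.add_apply, ← Finset.sum_add_distrib]
    refine Finset.sum_congr rfl fun v _ => Finset.sum_congr rfl fun a _ => ?_
    split_ifs
    · ring
    · simp
  map_smul' c f := by
    funext σ
    simp only [Pi.smul_apply, smul_eq_mul, RingHom.id_apply, Finset.mul_sum]
    refine Finset.sum_congr rfl fun v _ => Finset.sum_congr rfl fun a _ => ?_
    split_ifs
    · ring
    · simp

open Classical in
/-- The eigenvalues `λ₁ ≤ λ₂ ≤ …` of `-𝓛` in increasing order, listed with multiplicity
(the chain is reversible, so all of them are real). -/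
noncomputable def eigenvalueList : List ℝ :=
  (-(α.generator H)).charpoly.roots.sort

/-- The relaxation time `τ₂ = 1 / λ₂`. It is `∞` if `λ₂ = 0`, that is, if the dynamics is not
irreducible on the legal configurations, and `0` if there is no second eigenvalue, that is, if there
are fewer than two legal configurations. -/
noncomputable def relaxationTime : ℝ≥0∞ :=
  match (α.eigenvalueList H)[1]? with
  | some l => (ENNReal.ofReal l)⁻¹
  | none => 0

end FiniteGraph
end SpinSystem

namespace SimpleGraph

/-- `V_r`, the set of vertices at distance at most `r` from `ρ`. -/
def closedBall {V : Type*} (G : SimpleGraph V) (ρ : V) (r : ℕ) : Set V :=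
  {v | G.edist ρ v ≤ r}

/-- The vertices at distance exactly `r` from `ρ`, as a subset of `V_r`. -/
def sphereIn {V : Type*} (G : SimpleGraph V) (ρ : V) (r : ℕ) : Set (G.closedBall ρ r) :=
  {v | G.edist ρ v = r}

theorem finite_closedBall {V : Type*} (G : SimpleGraph V) [G.LocallyFinite] (ρ : V) (r : ℕ) :
    (G.closedBall ρ r).Finite := by
  induction r with
  | zero =>
    refine (Set.finite_singleton ρ).subset fun v hv => ?_
    have h0 : G.edist ρ v ≤ 0 := hv
    exact (G.edist_eq_zero_iff.1 (nonpos_iff_eq_zero.1 h0)).symm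
  | succ r ih =>
    refine (ih.union (ih.biUnion fun w _ => (G.neighborSet w).toFinite)).subset fun v hv => ?_
    have hv' : G.edist v ρ ≤ (r + 1 : ℕ) := by rw [edist_comm]; exact hv
    obtain ⟨p, hp⟩ := G.exists_walk_of_edist_ne_top (ne_top_of_le_ne_top (ENat.natCast_ne_top _) hv')
    cases p with
    | nil => left; simp [closedBall]
    | @cons _ w _ hadj q =>
      right
      simp only [Set.mem_iUnion]
      refine ⟨w, ?_, hadj.symm⟩
      have h1 : ((q.length + 1 : ℕ) : ℕ∞) ≤ (r + 1 : ℕ) := by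
        rw [← Walk.length_cons hadj q, hp]; exact hv'
      have h2 : q.length ≤ r := by
        have := ENat.natCast_le_natCast.1 h1
        omega
      change G.edist ρ w ≤ r
      rw [edist_comm]
      exact (G.edist_le q).trans (by exact_mod_cast h2)

noncomputable instance fintypeClosedBall {V : Type*} (G : SimpleGraph V) [G.LocallyFinite] (ρ : V) (r : ℕ) :
    Fintype (G.closedBall ρ r) :=
  (G.finite_closedBall ρ r).fintype

end SimpleGraph

namespace SpinSystem

variable {V S : Type*} [Fintype S] (α : SpinSystem V S) (G : SimpleGraph V) [G.LocallyFinite]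
  (ρ : V) (r : ℕ)

/-- The Gibbs weight of a configuration on `G_r`, the subgraph of `G` induced on `V_r`. -/
noncomputable def ballWeight (σ : G.closedBall ρ r → S) : ℝ≥0 :=
  (α.restrict (G.closedBall ρ r)).configWeight (G.induce (G.closedBall ρ r)) σ

/-- The Gibbs distribution on `G_r`. -/
noncomputable def ballGibbs [MeasurableSpace S] : Measure (G.closedBall ρ r → S) :=
  (α.restrict (G.closedBall ρ r)).gibbs (G.induce (G.closedBall ρ r))

/-- The relaxation time `τ₂(G_r)` of the Glauber dynamics on `G_r`. -/
noncomputable def ballRelaxationTime : ℝ≥0∞ :=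
  (α.restrict (G.closedBall ρ r)).relaxationTime (G.induce (G.closedBall ρ r))

end SpinSystem

/-- The mutual information `I[X, Y]` (in nats) of two random variables on `(Ω, μ)`: the
Kullback-Leibler divergence of the joint law from the product of the marginal laws. -/
noncomputable def mutualInformation {Ω β γ : Type*} [MeasurableSpace Ω] [MeasurableSpace β]
    [MeasurableSpace γ] (X : Ω → β) (Y : Ω → γ) (μ : Measure Ω) : ℝ≥0∞ :=
  InformationTheory.klDiv (μ.map fun ω => (X ω, Y ω)) ((μ.map X).prod (μ.map Y))

/-- The configuration `σ_U` on a vertex set `U`. -/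
def spinsOn {W S : Type*} (U : Set W) (σ : W → S) : U → S := fun v => σ v

/-! Resampling the spin at `v` is the conditional expectation given the spins off `v`, hence an
orthogonal projection `T v` of `L²(μ)`, and the negative generator is `∑ v, (1 - T v)`. With `N`
vertices, the average `Q = N⁻¹ ∑ v, T v` is the discrete chain that updates a uniformly random
vertex. For `f` of mean zero, `⟪f, g⟫` is compared with `⟪Q ^ n f, g⟫` in two ways.

Spectral gap: every eigenvalue of `Q` on the complement of the constants is at most `1 - l / N`, so
`‖Q ^ n f‖ ≤ exp (-l n / N) ‖f‖` (`norm_pow_apply_le_of_gap`).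

Finite speed: an update only enlarges the set of spins on which `f` depends by the neighbours of a
vertex already in it, and it can be moved onto `g` and dropped unless it takes place on the sphere.
Weigh a vertex by `φ v = exp (dist ρ v)`. The expected weight of the dependence set grows by a
factor at most `1 + C / N` per step, while reaching the sphere requires weight at least `exp r`; a
Markov-type bound gives `abs_inner_pow_average_sub_inner_le`.

With `n` a small multiple of `r N` both errors are exponentially small in `r`, uniformly in `N`.
This is the covariance bound. For the mutual information, relative entropy is at most the
`χ²`-divergence, and for each value of `σ_A` the `χ²` term is controlled by the covariance of its
indicator with one well-chosen function of `σ_r`. -/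

/-! ### Contraction from a spectral gap. -/

section SpectralGap

open scoped InnerProductSpace

variable {E : Type*} [NormedAddCommGroup E] [InnerProductSpace ℝ E]

/-- Only the head of the sorted list can lie below its second entry. This turns the list description
of `λ₂` into a count with multiplicity; the hypothesis is vacuous when there is no second entry. -/
theorem Multiset.card_filter_lt_le_one_of_sort {s : Multiset ℝ} {l : ℝ}
    (h : ∀ x, s.sort[1]? = some x → l ≤ x) : (s.filter (· < l)).card ≤ 1 := by
  have hs := s.sort_eq (· ≤ ·)
  have hp := s.pairwise_sort (· ≤ ·)
  generalize s.sort (· ≤ ·) = L at h hs hp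
  subst hs
  match L, h, hp with
  | [], _, _ => simp
  | [a], _, _ => exact (Multiset.card_le_card (Multiset.filter_le _ _)).trans (by simp)
  | a :: b :: t, h, hp =>
    have hb : l ≤ b := h b rfl
    rw [List.pairwise_cons] at hp
    have ht : ((b :: t : List ℝ) : Multiset ℝ).filter (· < l) = 0 := by
      rw [Multiset.filter_eq_nil]
      intro x hx
      rw [Multiset.mem_coe, List.mem_cons] at hx
      rcases hx with rfl | hx
      · exact not_lt.2 hb
      · exact not_lt.2 (hb.trans ((List.pairwise_cons.1 hp.2).1 x hx))
    rw [← Multiset.cons_coe]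
    by_cases ha : a < l
    · rw [Multiset.filter_cons_of_pos (p := (· < l)) _ ha, ht]; simp
    · rw [Multiset.filter_cons_of_neg (p := (· < l)) _ ha, ht]; simp

/-- If the second smallest eigenvalue of a symmetric operator `M ≤ N` with
kernel vector `u` is at least `l`, then the powers of `1 - M / N` contract the orthogonal complement
of `u` at rate `exp (-l / N)`. -/
theorem LinearMap.IsSymmetric.norm_pow_apply_le_of_gap [FiniteDimensional ℝ E]
    {M : E →ₗ[ℝ] E} (hM : M.IsSymmetric) {N l : ℝ} (hN : 0 < N)
    (hle : ∀ x, ⟪M x, x⟫_ℝ ≤ N * ‖x‖ ^ 2)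
    (hl : 0 < l)
    (hgap : ∀ x, M.charpoly.roots.sort[1]? = some x → l ≤ x)
    {u : E} (hu : M u = 0) (hu0 : u ≠ 0) {f : E} (hf : ⟪u, f⟫_ℝ = 0) (n : ℕ) :
    ‖((1 - N⁻¹ • M : E →ₗ[ℝ] E) ^ n) f‖ ≤ Real.exp (-(l / N) * n) * ‖f‖ := by
  set b := hM.eigenvectorBasis rfl with hb
  set e := hM.eigenvalues rfl with he
  have hMb : ∀ i, M (b i) = e i • b i := fun i => hM.apply_eigenvectorBasis rfl i
  have hle' : ∀ i, e i ≤ N := fun i => by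
    have := hle (b i)
    rwa [hMb, real_inner_smul_left, real_inner_self_eq_norm_sq, b.norm_eq_one, one_pow, mul_one,
      mul_one] at this
  have hfew : ∀ i j, e i < l → e j < l → i = j := by
    have h1 := Multiset.card_filter_lt_le_one_of_sort hgap
    rw [hM.roots_charpoly_eq_eigenvalues rfl, Multiset.filter_map, Multiset.card_map,
      ← Finset.filter_val, Finset.card_val, Finset.card_le_one] at h1
    intro i j hi hj
    exact h1 i (by simpa using hi) j (by simpa using hj)
  have hub : ∀ i, e i * ⟪b i, u⟫_ℝ = 0 := fun i => by
    rw [← real_inner_smul_left, ← hMb, hM, hu, inner_zero_right]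
  -- An eigenvector `b i₀` not orthogonal to `u` has eigenvalue `0 < l`, so it is the only one below
  -- `l`. Hence `u` is a multiple of `b i₀`, and `f` has no component along it.
  obtain ⟨i₀, hi₀⟩ : ∃ i, ⟪b i, u⟫_ℝ ≠ 0 := by
    by_contra! h
    have h1 := b.sum_sq_norm_inner_right u
    simp only [h, norm_zero] at h1
    exact hu0 (by simpa using h1.symm)
  have hi₀l : e i₀ < l := by
    rcases mul_eq_zero.1 (hub i₀) with h | h
    · rwa [h]
    · exact absurd h hi₀
  have hei : ∀ i, i ≠ i₀ → l ≤ e i := fun i hi => by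
    by_contra! h
    exact hi (hfew i i₀ h hi₀l)
  have hf₀ : ⟪b i₀, f⟫_ℝ = 0 := by
    have h1 := b.sum_inner_mul_inner u f
    rw [hf, Finset.sum_eq_single i₀] at h1
    · exact (mul_eq_zero.1 h1).resolve_left (by rwa [real_inner_comm])
    · intro i _ hi
      have := (mul_eq_zero.1 (hub i)).resolve_left (hl.trans_le (hei i hi)).ne'
      rw [real_inner_comm, this, zero_mul]
    · simp
  have hQ : ∀ n : ℕ, ∀ i, ⟪b i, ((1 - N⁻¹ • M : E →ₗ[ℝ] E) ^ n) f⟫_ℝ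
      = (1 - e i / N) ^ n * ⟪b i, f⟫_ℝ := by
    intro n
    induction n with
    | zero => simp
    | succ n ih =>
      intro i
      rw [pow_succ', Module.End.mul_apply, LinearMap.sub_apply, Module.End.one_apply,
        LinearMap.smul_apply, inner_sub_right, real_inner_smul_right, ← hM, hMb,
        real_inner_smul_left, ih]
      ring
  refine le_of_sq_le_sq ?_ (by positivity)
  rw [mul_pow, ← b.sum_sq_norm_inner_right, ← b.sum_sq_norm_inner_right f, Finset.mul_sum]
  refine Finset.sum_le_sum fun i _ => ?_
  rw [hQ]
  by_cases hi : i = i₀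
  · rw [hi, hf₀]; simp
  · rw [norm_mul, mul_pow]
    gcongr
    rw [norm_pow]
    -- The upper bound `e i ≤ N` excludes negative eigenvalues of `1 - M / N`, which could otherwise
    -- be large in absolute value.
    have h1 : 0 ≤ 1 - e i / N := by
      rw [sub_nonneg, div_le_one hN]; exact hle' i
    rw [Real.norm_of_nonneg h1, mul_comm, Real.exp_nat_mul]
    gcongr
    have h2 := Real.add_one_le_exp (-(l / N))
    have h3 : l / N ≤ e i / N := by gcongr; exact hei i hi
    linarith

end SpectralGap

/-! ### Finite speed of propagation. -/

section Propagation

open scoped InnerProductSpace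

variable {E W : Type*} [NormedAddCommGroup E] [InnerProductSpace ℝ E] [Fintype W] [DecidableEq W]

/-- Finite speed of propagation for the average `Q` of symmetric contractions `T v` indexed by the
vertices of a graph: as long as `Q ^ n` does not transport the support `U` of `f` to the set `B`,
the pairing with an observable `g` which is fixed by `T v` for `v ∉ B` does not change. -/
theorem abs_inner_pow_average_sub_inner_le (T : W → E →ₗ[ℝ] E)
    (hT : ∀ v, (T v).IsSymmetric) (hT1 : ∀ v x, ‖T v x‖ ≤ ‖x‖)
    (L : Finset W → E → Prop) (nb : W → Finset W)
    (hL : ∀ U x v, L U x → v ∉ U → T v x = x)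
    (hLT : ∀ U x v, L U x → v ∈ U → L (U ∪ nb v) (T v x))
    (φ : W → ℝ) (hφ : ∀ v, 0 ≤ φ v) {C R N : ℝ} (hC : 0 ≤ C) (hR : 0 < R)
    (hcard : (Fintype.card W : ℝ) = N) (hN : 0 < N)
    (hnb : ∀ v, ∑ w ∈ nb v, φ w ≤ C * φ v)
    (B : Finset W) (hB : ∀ v ∈ B, R ≤ φ v) {g : E} (hg : ∀ v, v ∉ B → T v g = g) (n : ℕ) :
    ∀ (U : Finset W) (f : E), L U f →
      |⟪((N⁻¹ • ∑ v, T v : E →ₗ[ℝ] E) ^ n) f, g⟫_ℝ - ⟪f, g⟫_ℝ|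
        ≤ 2 / R * (∑ u ∈ U, φ u) * (1 + C / N) ^ n * (‖f‖ * ‖g‖) := by
  set Q : E →ₗ[ℝ] E := N⁻¹ • ∑ v, T v with hQ
  have hQ1 : ∀ x, ‖Q x‖ ≤ ‖x‖ := fun x => by
    rw [hQ, LinearMap.smul_apply, LinearMap.sum_apply, norm_smul, Real.norm_of_nonneg (by positivity),
      inv_mul_le_iff₀ hN, ← hcard]
    refine (norm_sum_le _ _).trans ((Finset.sum_le_sum fun v _ => hT1 v x).trans ?_)
    simp
  have hQn : ∀ (n : ℕ) x, ‖(Q ^ n) x‖ ≤ ‖x‖ := fun n => by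
    induction n with
    | zero => simp
    | succ n ih =>
      intro x
      rw [pow_succ, Module.End.mul_apply]
      exact (ih _).trans (hQ1 x)
  induction n with
  | zero => intro U f _; simp; have := Finset.sum_nonneg fun u (_ : u ∈ U) => hφ u; positivity
  | succ n ih =>
    intro U f hf
    set K := (1 + C / N) ^ n with hK
    have hK1 : 1 ≤ K := one_le_pow₀ (by have : 0 ≤ C / N := by positivity
                                        linarith)
    set F := ∑ u ∈ U, φ u with hF
    have hF0 : 0 ≤ F := Finset.sum_nonneg fun u _ => hφ u
    -- Condition on the vertex `v` of the first update; `F + C φ v` bounds the weight of the new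
    -- dependence set, which changes only if `v ∈ U`.
    have hterm : ∀ v, |⟪(Q ^ n) (T v f), g⟫_ℝ - ⟪f, g⟫_ℝ|
        ≤ 2 / R * K * (‖f‖ * ‖g‖) * (F + if v ∈ U then C * φ v else 0) := by
      intro v
      by_cases hvU : v ∈ U
      · rw [if_pos hvU]
        -- If the dependence set already meets `B`, its weight is at least `R`, and the trivial
        -- Cauchy–Schwarz bound `2 ‖f‖ ‖g‖` suffices.
        by_cases hvB : v ∈ B
        · have hRF : R ≤ F :=
            (hB v hvB).trans (Finset.single_le_sum (fun u _ => hφ u) hvU)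
          have h1 : |⟪(Q ^ n) (T v f), g⟫_ℝ - ⟪f, g⟫_ℝ| ≤ 2 * (‖f‖ * ‖g‖) := by
            refine (abs_sub _ _).trans ?_
            have h2 := abs_real_inner_le_norm ((Q ^ n) (T v f)) g
            have h3 := abs_real_inner_le_norm f g
            have h4 : ‖(Q ^ n) (T v f)‖ * ‖g‖ ≤ ‖f‖ * ‖g‖ := by
              gcongr
              exact (hQn n _).trans (hT1 v f)
            linarith
          refine h1.trans ?_
          have h5 : 1 ≤ (F + C * φ v) / R := by
            rw [one_le_div hR]
            have := mul_nonneg hC (hφ v)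
            linarith
          calc 2 * (‖f‖ * ‖g‖) = 2 * (‖f‖ * ‖g‖) * (1 * 1) := by ring
            _ ≤ 2 * (‖f‖ * ‖g‖) * (K * ((F + C * φ v) / R)) := by gcongr
            _ = _ := by field_simp
        · have h1 : ⟪f, g⟫_ℝ = ⟪T v f, g⟫_ℝ := by rw [hT v, hg v hvB]
          rw [h1]
          refine (ih _ _ (hLT U f v hf hvU)).trans ?_
          have h2 : ∑ u ∈ U ∪ nb v, φ u ≤ F + C * φ v := by
            refine le_trans ?_ (add_le_add_right (hnb v) F)
            rw [hF, ← Finset.sum_union_inter]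
            exact le_add_of_nonneg_right (Finset.sum_nonneg fun u _ => hφ u)
          have h3 : 0 ≤ F + C * φ v := by
            have := mul_nonneg hC (hφ v)
            linarith
          calc 2 / R * (∑ u ∈ U ∪ nb v, φ u) * K * (‖T v f‖ * ‖g‖)
              ≤ 2 / R * (F + C * φ v) * K * (‖f‖ * ‖g‖) := by
                gcongr
                exact hT1 v f
            _ = _ := by ring
      · rw [if_neg hvU, add_zero, hL U f v hf hvU]
        refine (ih U f hf).trans (le_of_eq ?_)
        ring
    have hsum : ⟪(Q ^ (n + 1)) f, g⟫_ℝ - ⟪f, g⟫_ℝ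
        = N⁻¹ * ∑ v, (⟪(Q ^ n) (T v f), g⟫_ℝ - ⟪f, g⟫_ℝ) := by
      rw [pow_succ, Module.End.mul_apply, hQ, LinearMap.smul_apply, LinearMap.sum_apply, ← hQ,
        map_smul, map_sum, real_inner_smul_left, sum_inner, Finset.sum_sub_distrib,
        Finset.sum_const, Finset.card_univ, nsmul_eq_mul, hcard]
      field_simp
    rw [hsum, abs_mul, abs_of_nonneg (by positivity), inv_mul_le_iff₀ hN]
    refine (Finset.abs_sum_le_sum_abs _ _).trans
      ((Finset.sum_le_sum fun v _ => hterm v).trans (le_of_eq ?_))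
    -- Summing over `v` gives `N F + C F`; division by `N` yields the additional factor `1 + C / N`.
    rw [← Finset.mul_sum, Finset.sum_add_distrib, Finset.sum_const, Finset.card_univ, nsmul_eq_mul,
      hcard, Finset.sum_ite_mem, Finset.univ_inter, ← Finset.mul_sum, pow_succ, ← hF, ← hK]
    field_simp

end Propagation

/-! ### Balancing the gap against the propagation speed. -/

section Mixing

open scoped InnerProductSpace

variable {E W : Type*} [NormedAddCommGroup E] [InnerProductSpace ℝ E] [FiniteDimensional ℝ E]
  [Fintype W] [DecidableEq W]

/-- Decay of correlations for a family of symmetric projections with finite range and a spectral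
gap. -/
theorem inner_le_of_gap_of_finite_range [Nonempty W] (T : W → E →ₗ[ℝ] E)
    (hT : ∀ v, (T v).IsSymmetric) (hTT : ∀ v x, T v (T v x) = T v x)
    (L : Finset W → E → Prop) (nb : W → Finset W)
    (hL : ∀ U x v, L U x → v ∉ U → T v x = x)
    (hLT : ∀ U x v, L U x → v ∈ U → L (U ∪ nb v) (T v x))
    {u : E} (hu : ∀ v, T v u = u) (hu0 : u ≠ 0) {l : ℝ} (hl : 0 < l)
    (hgap : ∀ x, (-∑ v, (T v - 1)).charpoly.roots.sort[1]? = some x → l ≤ x)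
    (φ : W → ℝ) (hφ : ∀ v, 0 ≤ φ v) {C t : ℝ} (hC : 0 < C) (ht : 0 ≤ t)
    (hnb : ∀ v, ∑ w ∈ nb v, φ w ≤ C * φ v)
    (B : Finset W) (hB : ∀ v ∈ B, Real.exp t ≤ φ v)
    {U : Finset W} {f g : E} (hf : L U f) (hg : ∀ v, v ∉ B → T v g = g) (hfu : ⟪u, f⟫_ℝ = 0) :
    ⟪f, g⟫_ℝ ≤ (2 * (∑ v ∈ U, φ v) * Real.exp (-(t / 2)) + Real.exp l * Real.exp (-(l * t / (2 * C))))
      * (‖f‖ * ‖g‖) := by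
  have hT1 : ∀ v x, ‖T v x‖ ≤ ‖x‖ := fun v x => by
    by_contra! h
    have h1 : ‖T v x‖ * ‖T v x‖ ≤ ‖T v x‖ * ‖x‖ := by
      rw [← real_inner_self_eq_norm_mul_norm, hT v, hTT, real_inner_comm]
      exact real_inner_le_norm _ _
    have h0 : 0 < ‖T v x‖ := (norm_nonneg x).trans_lt h
    exact absurd (le_of_mul_le_mul_left h1 h0) (not_le.2 h)
  have hTpos : ∀ v x, 0 ≤ ⟪T v x, x⟫_ℝ := fun v x => by
    rw [← hTT, hT v]; exact real_inner_self_nonneg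
  set N := (Fintype.card W : ℝ) with hN
  have hN0 : 0 < N := by rw [hN]; exact_mod_cast Fintype.card_pos
  have hN1 : 1 ≤ N := by rw [hN]; exact_mod_cast Fintype.card_pos
  set M : E →ₗ[ℝ] E := -∑ v, (T v - 1) with hMdef
  have hMx : ∀ x, M x = N • x - ∑ v, T v x := fun x => by
    simp [hMdef, Finset.sum_sub_distrib, hN, Nat.cast_smul_eq_nsmul, Module.End.natCast_apply]
  have hM : M.IsSymmetric := fun x y => by
    simp only [hMx, inner_sub_left, inner_sub_right, sum_inner, inner_sum, real_inner_smul_left,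
      real_inner_smul_right, fun v => hT v x y]
  have hMxx : ∀ x, ⟪M x, x⟫_ℝ = N * ‖x‖ ^ 2 - ∑ v, ⟪T v x, x⟫_ℝ := fun x => by
    rw [hMx, inner_sub_left, sum_inner, real_inner_smul_left, real_inner_self_eq_norm_sq]
  have hle : ∀ x, ⟪M x, x⟫_ℝ ≤ N * ‖x‖ ^ 2 := fun x => by
    rw [hMxx]
    have := Finset.sum_nonneg fun v (_ : v ∈ Finset.univ) => hTpos v x
    linarith
  have hMu : M u = 0 := by
    rw [hMx, Finset.sum_congr rfl fun v _ => hu v, Finset.sum_const, Finset.card_univ, hN,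
      Nat.cast_smul_eq_nsmul, sub_self]
  have hQ : (1 - N⁻¹ • M : E →ₗ[ℝ] E) = N⁻¹ • ∑ v, T v := by
    ext x
    simp [hMx, smul_sub, hN0.ne']
  -- This is continuous time `t / (2 C)`: the dependence weight grows by at most `exp (t / 2)`, half
  -- of the exponent needed to reach `B`, while the gap still gains `exp (-l t / (2 C))`.
  set n := ⌊t * N / (2 * C)⌋₊ with hn
  have hn1 : (n : ℝ) ≤ t * N / (2 * C) := Nat.floor_le (by positivity)
  have hn2 : t * N / (2 * C) < n + 1 := Nat.lt_floor_add_one _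
  have h1 := hM.norm_pow_apply_le_of_gap hN0 hle hl hgap hMu hu0 hfu n
  rw [hQ] at h1
  have h2 := abs_inner_pow_average_sub_inner_le T hT hT1 L nb hL hLT φ hφ hC.le (Real.exp_pos t)
    hN.symm hN0 hnb B hB hg n U f hf
  have h3 := real_inner_le_norm (((N⁻¹ • ∑ v, T v : E →ₗ[ℝ] E) ^ n) f) g
  -- Rounding `n` down loses less than one step, which costs a factor at most `exp (l / N) ≤ exp l`.
  have hexp1 : Real.exp (-(l / N) * n) ≤ Real.exp l * Real.exp (-(l * t / (2 * C))) := by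
    rw [← Real.exp_add, Real.exp_le_exp]
    have h4 : l / N * (t * N / (2 * C)) ≤ l / N * (n + 1) := by gcongr
    have h5 : l / N * (t * N / (2 * C)) = l * t / (2 * C) := by field_simp
    have h6 : l / N ≤ l := div_le_self hl.le hN1
    linarith
  have hexp2 : 1 / Real.exp t * (1 + C / N) ^ n ≤ Real.exp (-(t / 2)) := by
    have h4 : (1 + C / N) ^ n ≤ Real.exp (t / 2) := by
      calc (1 + C / N) ^ n ≤ Real.exp (C / N) ^ n := by
            gcongr
            have := Real.add_one_le_exp (C / N)
            linarith
        _ = Real.exp (n * (C / N)) := (Real.exp_nat_mul _ _).symm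
        _ ≤ Real.exp (t / 2) := by
            rw [Real.exp_le_exp]
            calc n * (C / N) ≤ t * N / (2 * C) * (C / N) := by gcongr
              _ = t / 2 := by field_simp
    calc 1 / Real.exp t * (1 + C / N) ^ n ≤ 1 / Real.exp t * Real.exp (t / 2) := by gcongr
      _ = Real.exp (-(t / 2)) := by
        rw [one_div, ← Real.exp_neg, ← Real.exp_add]; congr 1; ring
  have hF0 : 0 ≤ ∑ v ∈ U, φ v := Finset.sum_nonneg fun u _ => hφ u
  have h7 : 2 / Real.exp t * (∑ v ∈ U, φ v) * (1 + C / N) ^ n * (‖f‖ * ‖g‖)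
      ≤ 2 * (∑ v ∈ U, φ v) * Real.exp (-(t / 2)) * (‖f‖ * ‖g‖) := by
    calc _ = 2 * (∑ v ∈ U, φ v) * (1 / Real.exp t * (1 + C / N) ^ n) * (‖f‖ * ‖g‖) := by ring
      _ ≤ _ := by gcongr
  have h8 : ‖((N⁻¹ • ∑ v, T v : E →ₗ[ℝ] E) ^ n) f‖ * ‖g‖
      ≤ Real.exp l * Real.exp (-(l * t / (2 * C))) * (‖f‖ * ‖g‖) := by
    calc _ ≤ Real.exp (-(l / N) * n) * ‖f‖ * ‖g‖ := by gcongr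
      _ = Real.exp (-(l / N) * n) * (‖f‖ * ‖g‖) := by ring
      _ ≤ _ := by gcongr
  have h9 := (abs_le.1 h2).1
  rw [add_mul]
  linarith

end Mixing

/-! ### Heat-bath updates as reversible projections. -/

namespace SpinSystem

section HeatBath

open scoped InnerProductSpace

variable {W S : Type*} [Fintype W] (α : SpinSystem W S) (H : SimpleGraph W)

open Classical in
theorem localWeight_congr {σ τ : W → S} {v : W} (h : ∀ w, H.Adj v w → σ w = τ w) (a : S) :
    α.localWeight H σ v a = α.localWeight H τ v a := by
  unfold localWeight
  refine Finset.prod_congr rfl fun w hw => ?_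
  rw [h w (by simpa using hw)]

open Classical in
theorem localWeight_update (σ : W → S) (v : W) (b a : S) :
    α.localWeight H (Function.update σ v b) v a = α.localWeight H σ v a :=
  α.localWeight_congr H (fun _ hw => Function.update_of_ne hw.ne' _ _) a

open Classical in
/-- The Gibbs weight splits into the edges avoiding `v` and the edges at `v`. -/
theorem configWeight_eq_mul_localWeight (σ : W → S) (v : W) :
    α.configWeight H σ = (∏ e ∈ H.edgeFinset with v ∉ e,
      Sym2.lift ⟨fun x y => α.weight x y (σ x) (σ y), fun x y => α.symm x y (σ x) (σ y)⟩ e)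
        * α.localWeight H σ v (σ v) := by
  unfold configWeight localWeight
  rw [← Finset.prod_filter_not_mul_prod_filter _ (fun e => v ∈ e)]
  congr 1
  symm
  refine Finset.prod_bij (fun w _ => s(v, w)) (fun w hw => ?_) (fun w _ w' _ h => ?_)
    (fun e he => ?_) (fun w _ => rfl)
  · simpa using hw
  · exact Sym2.congr_right.1 h
  · rw [Finset.mem_filter] at he
    obtain ⟨w, rfl⟩ := he.2
    exact ⟨w, by simpa using he.1, rfl⟩

open Classical in
-- Detailed balance before normalisation: the edges avoiding `v` do not see the update, and the
-- local weights at `v` do not depend on the spin at `v`.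
theorem configWeight_mul_localWeight (σ : W → S) (v : W) (a : S) :
    α.configWeight H σ * α.localWeight H σ v a
      = α.configWeight H (Function.update σ v a) * α.localWeight H σ v (σ v) := by
  rw [α.configWeight_eq_mul_localWeight H σ v,
    α.configWeight_eq_mul_localWeight H (Function.update σ v a) v, localWeight_update,
    Function.update_self, mul_right_comm]
  congr 2
  refine Finset.prod_congr rfl fun e he => ?_
  rw [Finset.mem_filter] at he
  have hv := he.2
  induction e using Sym2.ind with
  | _ x y =>
    rw [Sym2.mem_iff, not_or] at hv
    simp [Function.update_of_ne (Ne.symm hv.1), Function.update_of_ne (Ne.symm hv.2)]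

open Classical in
/-- Extension by zero of an observable of the legal configurations. -/
noncomputable def extendLegal (f : α.Legal H → ℝ) (σ : W → S) : ℝ :=
  if h : α.configWeight H σ ≠ 0 then f ⟨σ, h⟩ else 0

theorem extendLegal_of_legal (f : α.Legal H → ℝ) (σ : α.Legal H) :
    α.extendLegal H f σ.1 = f σ := by
  rw [extendLegal, dif_pos σ.2]

variable [Fintype S]

theorem rate_congr {σ τ : W → S} {v : W} (h : ∀ w, H.Adj v w → σ w = τ w) (a : S) :
    α.rate H σ v a = α.rate H τ v a := by
  simp only [rate, α.localWeight_congr H h]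

open Classical in
theorem rate_update (σ : W → S) (v : W) (b a : S) :
    α.rate H (Function.update σ v b) v a = α.rate H σ v a :=
  α.rate_congr H (fun _ hw => Function.update_of_ne hw.ne' _ _) a

open Classical in
/-- Detailed balance. -/
theorem configWeight_mul_rate (σ : W → S) (v : W) (a : S) :
    (α.configWeight H σ : ℝ) * α.rate H σ v a
      = α.configWeight H (Function.update σ v a)
        * α.rate H (Function.update σ v a) v (σ v) := by
  rw [rate_update]
  unfold rate
  rw [← mul_div_assoc, ← mul_div_assoc]
  congr 1
  exact_mod_cast α.configWeight_mul_localWeight H σ v a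

theorem sum_rate {σ : W → S} (hσ : α.configWeight H σ ≠ 0) (v : W) :
    ∑ a, α.rate H σ v a = 1 := by
  unfold rate
  rw [← Finset.sum_div, div_self]
  rw [α.configWeight_eq_mul_localWeight H σ v] at hσ
  have h1 : 0 < α.localWeight H σ v (σ v) := pos_iff_ne_zero.2 (right_ne_zero_of_mul hσ)
  exact (Finset.sum_pos' (fun _ _ => by positivity) ⟨σ v, Finset.mem_univ _, by exact_mod_cast h1⟩).ne'

open Classical in
/-- Averaging over the spin at `v`, resampled by the heat bath. -/
noncomputable def heatBath (v : W) (F : (W → S) → ℝ) (σ : W → S) : ℝ :=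
  ∑ a, α.rate H σ v a * F (Function.update σ v a)

open Classical in
-- Self-adjointness follows from detailed balance through the involution `(σ, a) ↦ (σ_v^a, σ_v)`.
theorem sum_configWeight_mul_heatBath (v : W) (F G : (W → S) → ℝ) :
    ∑ σ, (α.configWeight H σ : ℝ) * (α.heatBath H v F σ * G σ)
      = ∑ σ, (α.configWeight H σ : ℝ) * (F σ * α.heatBath H v G σ) := by
  unfold heatBath
  simp only [Finset.mul_sum, Finset.sum_mul, ← Fintype.sum_prod_type']
  let ι : (W → S) × S → (W → S) × S := fun p => (Function.update p.1 v p.2, p.1 v)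
  have hι : Function.Involutive ι := fun p => by simp [ι]
  refine Fintype.sum_equiv hι.toPerm _ _ fun p => ?_
  have h := α.configWeight_mul_rate H p.1 v p.2
  simp only [Function.Involutive.coe_toPerm, ι, Function.update_idem, Function.update_eq_self]
  linear_combination (F (Function.update p.1 v p.2) * G p.1) * h

open Classical in
/-- The heat bath at `v` as an operator on observables of the legal configurations. -/
noncomputable def legalHeatBath (v : W) : (α.Legal H → ℝ) →ₗ[ℝ] (α.Legal H → ℝ) where
  toFun f σ := α.heatBath H v (α.extendLegal H f) σ.1
  map_add' f g := by
    funext σ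
    simp only [heatBath, extendLegal, Pi.add_apply, ← Finset.sum_add_distrib]
    refine Finset.sum_congr rfl fun a _ => ?_
    split_ifs <;> ring
  map_smul' c f := by
    funext σ
    simp only [heatBath, extendLegal, Pi.smul_apply, smul_eq_mul, RingHom.id_apply, Finset.mul_sum]
    refine Finset.sum_congr rfl fun a _ => ?_
    split_ifs <;> ring

theorem legalHeatBath_apply (v : W) (f : α.Legal H → ℝ) (σ : α.Legal H) :
    α.legalHeatBath H v f σ = α.heatBath H v (α.extendLegal H f) σ.1 := rfl

open Classical in
-- Moves to illegal configurations have rate zero and the remaining rates sum to one, so invariance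
-- is needed only between legal configurations.
theorem legalHeatBath_eq_self {v : W} {f : α.Legal H → ℝ}
    (h : ∀ (σ : α.Legal H) (a : S) (ha : α.configWeight H (Function.update σ.1 v a) ≠ 0),
      f ⟨_, ha⟩ = f σ) : α.legalHeatBath H v f = f := by
  funext σ
  rw [legalHeatBath_apply, heatBath, ← one_mul (f σ), ← α.sum_rate H σ.2 v, Finset.sum_mul]
  refine Finset.sum_congr rfl fun a _ => ?_
  by_cases hr : α.rate H σ.1 v a = 0
  · rw [hr, zero_mul, zero_mul]
  · rw [extendLegal, dif_pos (α.legal_update_of_rate_ne_zero H σ.2 hr), h]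

open Classical in
theorem legalHeatBath_idem (v : W) (f : α.Legal H → ℝ) :
    α.legalHeatBath H v (α.legalHeatBath H v f) = α.legalHeatBath H v f := by
  refine α.legalHeatBath_eq_self H fun σ a ha => ?_
  simp only [legalHeatBath_apply, heatBath, rate_update, Function.update_idem]

open Classical in
-- Since the rates at each vertex sum to one, the term `-f σ` can be pulled out of the sum over
-- spins. This links `λ₂` to the average of the projections.
theorem generator_eq_sum : α.generator H = ∑ v, (α.legalHeatBath H v - 1) := by
  refine LinearMap.ext fun f => funext fun σ => ?_
  simp only [LinearMap.sum_apply, Finset.sum_apply, LinearMap.sub_apply, Pi.sub_apply,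
    Module.End.one_apply, legalHeatBath_apply]
  refine Finset.sum_congr rfl fun v _ => ?_
  have hf : f σ = ∑ a, α.rate H σ.1 v a * f σ := by
    rw [← Finset.sum_mul, α.sum_rate H σ.2 v, one_mul]
  conv_rhs => rw [hf, heatBath, ← Finset.sum_sub_distrib]
  refine Finset.sum_congr rfl fun a _ => ?_
  rw [← mul_sub]
  by_cases hr : α.rate H σ.1 v a = 0
  · simp [hr]
  · have h := α.legal_update_of_rate_ne_zero H σ.2 hr
    rw [dif_pos h, extendLegal, dif_pos h]

end HeatBath

/-! ### The Gibbs measure as a finite sum. -/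

section GibbsIntegral

variable {W S : Type*} [Fintype W] [Fintype S] (α : SpinSystem W S) (H : SimpleGraph W)

/-- The Gibbs probability of a configuration. -/
noncomputable def gibbsProb (σ : W → S) : ℝ :=
  (α.configWeight H σ : ℝ) / α.partitionFunction H

theorem partitionFunction_pos (hlegal : ∃ σ, α.configWeight H σ ≠ 0) :
    0 < α.partitionFunction H := by
  obtain ⟨σ, hσ⟩ := hlegal
  classical
  unfold partitionFunction
  exact Finset.sum_pos' (fun _ _ => zero_le) ⟨σ, Finset.mem_univ _, pos_iff_ne_zero.2 hσ⟩

theorem gibbsProb_nonneg (σ : W → S) : 0 ≤ α.gibbsProb H σ := by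
  unfold gibbsProb; positivity

open Classical in
theorem sum_gibbsProb (hlegal : ∃ σ, α.configWeight H σ ≠ 0) : ∑ σ, α.gibbsProb H σ = 1 := by
  have h := (α.partitionFunction_pos H hlegal).ne'
  unfold gibbsProb
  rw [← Finset.sum_div, div_eq_one_iff_eq (by exact_mod_cast h)]
  unfold partitionFunction
  push_cast
  rfl

variable [MeasurableSpace S] [DiscreteMeasurableSpace S]

open Classical in
instance isFiniteMeasure_gibbs : IsFiniteMeasure (α.gibbs H) := by
  unfold gibbs
  have := fun σ : W → S => Measure.smul_finite (Measure.dirac σ)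
    (ENNReal.coe_ne_top (r := α.configWeight H σ / α.partitionFunction H))
  infer_instance

open Classical in
theorem integral_gibbs (f : (W → S) → ℝ) :
    ∫ σ, f σ ∂(α.gibbs H) = ∑ σ, α.gibbsProb H σ * f σ := by
  unfold gibbs
  rw [integral_finsetSum_measure fun σ _ =>
    Integrable.smul_measure Integrable.of_finite ENNReal.coe_ne_top]
  refine Finset.sum_congr rfl fun σ _ => ?_
  rw [integral_smul_measure, integral_dirac, smul_eq_mul, gibbsProb]
  simp

theorem isProbabilityMeasure_gibbs (hlegal : ∃ σ, α.configWeight H σ ≠ 0) :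
    IsProbabilityMeasure (α.gibbs H) := by
  classical
  have h := α.integral_gibbs H fun _ => 1
  simp only [integral_const, smul_eq_mul, mul_one, α.sum_gibbsProb H hlegal] at h
  exact ⟨by rwa [measureReal_def, ENNReal.toReal_eq_one_iff] at h⟩

end GibbsIntegral

/-! ### Decay of covariance on a finite graph. -/

section Covariance

open scoped InnerProductSpace

variable {W S : Type*} [Fintype W] [Fintype S] (α : SpinSystem W S) (H : SimpleGraph W)

/-- The identification of `L²(μ)`, for the Gibbs distribution `μ`, with a Euclidean space. -/
noncomputable def gibbsL2 (hlegal : ∃ σ, α.configWeight H σ ≠ 0) :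
    (α.Legal H → ℝ) ≃ₗ[ℝ] EuclideanSpace ℝ (α.Legal H) :=
  (LinearEquiv.piCongrRight fun σ : α.Legal H => LinearEquiv.smulOfNeZero ℝ ℝ
    (√(α.gibbsProb H σ.1)) (Real.sqrt_ne_zero'.2 (div_pos
      (by exact_mod_cast pos_iff_ne_zero.2 σ.2)
      (by exact_mod_cast α.partitionFunction_pos H hlegal)))).trans
  (WithLp.linearEquiv 2 ℝ (α.Legal H → ℝ)).symm

theorem gibbsL2_apply (hlegal : ∃ σ, α.configWeight H σ ≠ 0) (f : α.Legal H → ℝ)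
    (σ : α.Legal H) : α.gibbsL2 H hlegal f σ = √(α.gibbsProb H σ.1) * f σ := rfl

theorem gibbsProb_eq_zero {σ : W → S} (h : α.configWeight H σ = 0) : α.gibbsProb H σ = 0 := by
  simp [gibbsProb, h]

open Classical in
-- Illegal configurations have probability zero, so any extensions `F`, `G` to all configurations
-- may be used.
theorem inner_gibbsL2 (hlegal : ∃ σ, α.configWeight H σ ≠ 0) {f g : α.Legal H → ℝ}
    {F G : (W → S) → ℝ} (hF : ∀ σ : α.Legal H, F σ.1 = f σ) (hG : ∀ σ : α.Legal H, G σ.1 = g σ) :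
    ⟪α.gibbsL2 H hlegal f, α.gibbsL2 H hlegal g⟫_ℝ = ∑ σ, α.gibbsProb H σ * (F σ * G σ) := by
  rw [← Finset.sum_filter_of_ne (p := fun σ => α.configWeight H σ ≠ 0),
    Finset.sum_subtype (p := fun σ => α.configWeight H σ ≠ 0) _ (by simp), PiLp.inner_apply]
  · refine Finset.sum_congr rfl fun σ _ => ?_
    have h2 := Real.mul_self_sqrt (α.gibbsProb_nonneg H σ.1)
    rw [gibbsL2_apply, gibbsL2_apply, hF, hG, RCLike.inner_apply, conj_trivial]
    linear_combination (f σ * g σ) * h2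
  · intro σ _ h h0
    exact h (by rw [α.gibbsProb_eq_zero H h0, zero_mul])

open Classical in
theorem inner_gibbsL2_legalHeatBath (hlegal : ∃ σ, α.configWeight H σ ≠ 0) (v : W)
    (f g : α.Legal H → ℝ) :
    ⟪α.gibbsL2 H hlegal (α.legalHeatBath H v f), α.gibbsL2 H hlegal g⟫_ℝ
      = ⟪α.gibbsL2 H hlegal f, α.gibbsL2 H hlegal (α.legalHeatBath H v g)⟫_ℝ := by
  rw [α.inner_gibbsL2 H hlegal (f := α.legalHeatBath H v f)
      (F := α.heatBath H v (α.extendLegal H f)) (fun _ => rfl) (α.extendLegal_of_legal H g),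
    α.inner_gibbsL2 H hlegal (g := α.legalHeatBath H v g)
      (G := α.heatBath H v (α.extendLegal H g)) (α.extendLegal_of_legal H f) (fun _ => rfl)]
  simp only [gibbsProb, div_mul_eq_mul_div, ← Finset.sum_div]
  rw [sum_configWeight_mul_heatBath]

variable [MeasurableSpace S] [DiscreteMeasurableSpace S]

open Classical in
/-- Decay of correlations of the Gibbs distribution on a finite graph whose Glauber dynamics has a
spectral gap `l`. The function `φ` grows at most by a bounded factor along the edges. -/
theorem covariance_gibbs_le [Nonempty W] (hlegal : ∃ σ, α.configWeight H σ ≠ 0)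
    {l : ℝ} (hl : 0 < l) (hgap : ∀ x, (α.eigenvalueList H)[1]? = some x → l ≤ x)
    (φ : W → ℝ) (hφ : ∀ v, 0 ≤ φ v) {C t : ℝ} (hC : 0 < C) (ht : 0 ≤ t)
    (hnb : ∀ v, ∑ w ∈ H.neighborFinset v, φ w ≤ C * φ v)
    (B : Set W) (hB : ∀ v ∈ B, Real.exp t ≤ φ v) (U : Finset W)
    {f g : (W → S) → ℝ} (hf : DependsOn f (U : Set W)) (hg : DependsOn g B) :
    cov[f, g; α.gibbs H] ≤
      (2 * (∑ v ∈ U, φ v) * Real.exp (-(t / 2)) + Real.exp l * Real.exp (-(l * t / (2 * C))))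
        * √(Var[f; α.gibbs H] * Var[g; α.gibbs H]) := by
  have := α.isProbabilityMeasure_gibbs H hlegal
  set e := α.gibbsL2 H hlegal
  let T : W → EuclideanSpace ℝ (α.Legal H) →ₗ[ℝ] EuclideanSpace ℝ (α.Legal H) :=
    fun v => e.conj (α.legalHeatBath H v)
  have hTe : ∀ v x, T v (e x) = e (α.legalHeatBath H v x) := fun v x => by
    simp [T, LinearEquiv.conj_apply]
  -- Dependence on the spins in `U` alone, tested only on pairs of legal configurations.
  let L : Finset W → EuclideanSpace ℝ (α.Legal H) → Prop := fun U x =>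
    ∀ σ τ : α.Legal H, (∀ v ∈ U, σ.1 v = τ.1 v) → e.symm x σ = e.symm x τ
  let center : ((W → S) → ℝ) → α.Legal H → ℝ := fun F σ => F σ.1 - ∫ τ, F τ ∂(α.gibbs H)
  have hinner : ∀ F G : (W → S) → ℝ, ⟪e (center F), e (center G)⟫_ℝ = cov[F, G; α.gibbs H] := by
    intro F G
    rw [α.inner_gibbsL2 H hlegal (F := fun σ => F σ - ∫ τ, F τ ∂(α.gibbs H))
      (G := fun σ => G σ - ∫ τ, G τ ∂(α.gibbs H)) (fun _ => rfl) (fun _ => rfl), covariance,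
      α.integral_gibbs H fun σ => _ * _]
  have hnorm : ∀ F : (W → S) → ℝ, ‖e (center F)‖ = √Var[F; α.gibbs H] := by
    intro F
    rw [← covariance_self (measurable_of_finite F).aemeasurable, ← hinner,
      real_inner_self_eq_norm_sq, Real.sqrt_sq (norm_nonneg _)]
  rw [Real.sqrt_mul (variance_nonneg _ _), ← hinner, ← hnorm, ← hnorm]
  have hmean : ∫ σ, (f σ - ∫ τ, f τ ∂(α.gibbs H)) ∂(α.gibbs H) = 0 := by
    rw [integral_sub Integrable.of_finite Integrable.of_finite]
    simp
  refine inner_le_of_gap_of_finite_range T ?_ ?_ L (fun v => H.neighborFinset v) ?_ ?_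
    (u := e 1) ?_ ?_ hl ?_ φ hφ hC ht hnb B.toFinset (by simpa using hB) ?_ ?_ ?_
  · intro v x y
    obtain ⟨x, rfl⟩ := e.surjective x
    obtain ⟨y, rfl⟩ := e.surjective y
    rw [hTe, hTe]
    exact α.inner_gibbsL2_legalHeatBath H hlegal v x y
  · intro v x
    obtain ⟨x, rfl⟩ := e.surjective x
    rw [hTe, hTe, legalHeatBath_idem]
  · intro U x v hx hv
    obtain ⟨x, rfl⟩ := e.surjective x
    rw [hTe, legalHeatBath_eq_self]
    intro σ a ha
    have := hx ⟨_, ha⟩ σ fun w hw => Function.update_of_ne (ne_of_mem_of_not_mem hw hv) _ _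
    simpa using this
  · intro U x v hx hv σ τ hστ
    obtain ⟨x, rfl⟩ := e.surjective x
    rw [hTe, LinearEquiv.symm_apply_apply, legalHeatBath_apply, legalHeatBath_apply]
    refine Finset.sum_congr rfl fun a _ => ?_
    have hr : α.rate H σ.1 v a = α.rate H τ.1 v a :=
      α.rate_congr H (fun w hw => hστ w (by simp [hw])) a
    -- With hard constraints an update may be illegal. The two rates agree, so they vanish together;
    -- otherwise both updated configurations are legal and can be compared.
    by_cases h0 : α.rate H σ.1 v a = 0
    · rw [← hr, h0, zero_mul, zero_mul]
    · have h1 := α.legal_update_of_rate_ne_zero H σ.2 h0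
      have h2 := α.legal_update_of_rate_ne_zero H τ.2 (hr ▸ h0)
      rw [hr, extendLegal, extendLegal, dif_pos h1, dif_pos h2]
      congr 1
      have := hx ⟨_, h1⟩ ⟨_, h2⟩ fun w hw => by
        by_cases hwv : w = v
        · subst hwv; simp
        · simpa [Function.update_of_ne hwv] using hστ w (by simp [hw])
      simpa using this
  · intro v
    rw [hTe, legalHeatBath_eq_self]
    intros; rfl
  · obtain ⟨σ, hσ⟩ := hlegal
    rw [Ne, LinearEquiv.map_eq_zero_iff]
    intro h
    exact one_ne_zero (congrFun h ⟨σ, hσ⟩)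
  · intro x hx
    refine hgap x ?_
    rw [eigenvalueList, ← hx, ← e.charpoly_conj]
    congr 4
    refine LinearMap.ext fun y => ?_
    obtain ⟨y, rfl⟩ := e.surjective y
    simp [LinearEquiv.conj_apply, generator_eq_sum, LinearMap.sum_apply, hTe, map_sum, map_sub]
    rw [← nsmul_eq_mul, map_nsmul]
  · intro σ τ hστ
    rw [LinearEquiv.symm_apply_apply]
    simp only [center]
    rw [hf fun v hv => hστ v hv]
  · intro v hv
    rw [hTe, legalHeatBath_eq_self]
    intro σ a ha
    simp only [center]
    rw [hg fun w hw => Function.update_of_ne (fun h => hv (by simpa [← h] using hw)) _ _]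
  · refine (α.inner_gibbsL2 H hlegal (F := fun _ => 1)
      (G := fun σ => f σ - ∫ τ, f τ ∂(α.gibbs H)) (fun _ => rfl) (fun _ => rfl)).trans ?_
    rw [← hmean, α.integral_gibbs H fun σ => _ - _]
    simp

end Covariance

end SpinSystem

/-! ### From covariances to mutual information. -/

section MutualInformation

/-- Insert `log x ≤ x - 1` into `x log x + 1 - x`. -/
theorem InformationTheory.klFun_le_sq_sub_one {x : ℝ} (hx : 0 ≤ x) : klFun x ≤ (x - 1) ^ 2 := by
  unfold klFun
  rcases hx.eq_or_lt with rfl | hx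
  · simp
  · nlinarith [mul_le_mul_of_nonneg_left (Real.log_le_sub_one_of_pos hx) hx.le]

/-- On a finite space, the Kullback-Leibler divergence is at most the `χ²`-divergence. -/
theorem InformationTheory.klDiv_le_chiSq {κ : Type*} [Fintype κ] [MeasurableSpace κ]
    [MeasurableSingletonClass κ] (P Q : Measure κ) [IsFiniteMeasure P] [IsFiniteMeasure Q]
    (h : P ≪ Q) :
    klDiv P Q ≤ ENNReal.ofReal (∑ x, (P.real {x} - Q.real {x}) ^ 2 / Q.real {x}) := by
  rw [klDiv_eq_lintegral_klFun_of_ac h, lintegral_fintype,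
    ENNReal.ofReal_sum_of_nonneg fun x _ => by positivity]
  refine Finset.sum_le_sum fun x _ => ?_
  have hx : P.rnDeriv Q x * Q {x} = P {x} := by
    conv_rhs => rw [← Measure.withDensity_rnDeriv_eq P Q h, withDensity_apply _ (measurableSet_singleton x),
      lintegral_singleton]
  have hx' : (P.rnDeriv Q x).toReal * Q.real {x} = P.real {x} := by
    rw [measureReal_def, measureReal_def, ← ENNReal.toReal_mul, hx]
  rw [← ENNReal.ofReal_toReal (measure_ne_top Q {x}), ← measureReal_def,
    ← ENNReal.ofReal_mul (klFun_nonneg ENNReal.toReal_nonneg)]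
  refine ENNReal.ofReal_le_ofReal ?_
  have h1 := klFun_le_sq_sub_one (ENNReal.toReal_nonneg (a := P.rnDeriv Q x))
  rw [← hx']
  generalize (P.rnDeriv Q x).toReal = t at h1
  rcases (measureReal_nonneg : 0 ≤ Q.real {x}).eq_or_lt with h0 | h0
  · rw [← h0]; simp
  · rw [le_div_iff₀ h0]
    nlinarith [mul_le_mul_of_nonneg_right h1 (sq_nonneg (Q.real {x}))]

/-- If the correlations between functions of `X` and functions of `Y` are at most `ε`, then the mutual
information of `X` and `Y` is at most `ε²` times the number of values of `X`. -/
theorem mutualInformation_le_of_covariance_le {Ω β γ : Type*} [Finite Ω] [Finite β] [Finite γ]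
    [MeasurableSpace Ω] [MeasurableSpace β] [MeasurableSpace γ] [MeasurableSingletonClass Ω]
    [MeasurableSingletonClass β] [MeasurableSingletonClass γ] (μ : Measure Ω)
    [IsProbabilityMeasure μ] (X : Ω → β) (Y : Ω → γ) {ε : ℝ}
    (h : ∀ (F : β → ℝ) (G : γ → ℝ), cov[fun ω => F (X ω), fun ω => G (Y ω); μ]
      ≤ ε * √(Var[fun ω => F (X ω); μ] * Var[fun ω => G (Y ω); μ])) :
    mutualInformation X Y μ ≤ ENNReal.ofReal (ε ^ 2 * Nat.card β) := by
  classical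
  have := Fintype.ofFinite β
  have := Fintype.ofFinite γ
  have hX : Measurable X := measurable_of_finite X
  have hY : Measurable Y := measurable_of_finite Y
  have hXY : Measurable fun ω => (X ω, Y ω) := measurable_of_finite _
  have := Measure.isProbabilityMeasure_map (μ := μ) hX.aemeasurable
  have := Measure.isProbabilityMeasure_map (μ := μ) hY.aemeasurable
  have := Measure.isProbabilityMeasure_map (μ := μ) hXY.aemeasurable
  set J := μ.map fun ω => (X ω, Y ω) with hJ
  set p : β → ℝ := fun a => (μ.map X).real {a} with hp
  set q : γ → ℝ := fun b => (μ.map Y).real {b} with hq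
  set j : β → γ → ℝ := fun a b => J.real {(a, b)} with hj
  have hprod : ∀ a b, ((μ.map X).prod (μ.map Y)).real {(a, b)} = p a * q b := fun a b => by
    rw [← Set.singleton_prod_singleton, measureReal_prod_prod]
  have hjp : ∀ a b, j a b ≤ p a := fun a b => by
    simp only [hj, hp, hJ, map_measureReal_apply hXY (measurableSet_singleton _),
      map_measureReal_apply hX (measurableSet_singleton _)]
    exact measureReal_mono fun ω hω => (congrArg Prod.fst hω : _)
  have hjq : ∀ a b, j a b ≤ q b := fun a b => by
    simp only [hj, hq, hJ, map_measureReal_apply hXY (measurableSet_singleton _),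
      map_measureReal_apply hY (measurableSet_singleton _)]
    exact measureReal_mono fun ω hω => (congrArg Prod.snd hω : _)
  have hac : J ≪ (μ.map X).prod (μ.map Y) := by
    intro s hs
    rw [measure_null_iff_singleton s.to_countable]
    rintro ⟨a, b⟩ hab
    have h1 := hprod a b
    rw [measureReal_def, measure_mono_null (Set.singleton_subset_iff.2 hab) hs,
      ENNReal.toReal_zero] at h1
    have h2 : j a b = 0 := by
      refine le_antisymm ?_ measureReal_nonneg
      rcases mul_eq_zero.1 h1.symm with h0 | h0
      · exact h0 ▸ hjp a b
      · exact h0 ▸ hjq a b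
    exact (measureReal_eq_zero_iff).1 h2
  have hEX : ∀ F : β → ℝ, ∫ ω, F (X ω) ∂μ = ∑ a, p a * F a := fun F => by
    rw [← integral_map hX.aemeasurable (measurable_of_finite F).aestronglyMeasurable,
      integral_fintype Integrable.of_finite]
    rfl
  have hEY : ∀ G : γ → ℝ, ∫ ω, G (Y ω) ∂μ = ∑ b, q b * G b := fun G => by
    rw [← integral_map hY.aemeasurable (measurable_of_finite G).aestronglyMeasurable,
      integral_fintype Integrable.of_finite]
    rfl
  have hEXY : ∀ K : β → γ → ℝ, ∫ ω, K (X ω) (Y ω) ∂μ = ∑ a, ∑ b, j a b * K a b := fun K => by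
    rw [← Fintype.sum_prod_type' fun a b => j a b * K a b]
    refine (integral_map (φ := fun ω => (X ω, Y ω)) (f := fun x => K x.1 x.2) hXY.aemeasurable
      (measurable_of_finite _).aestronglyMeasurable).symm.trans ?_
    rw [integral_fintype Integrable.of_finite]
    rfl
  refine (InformationTheory.klDiv_le_chiSq _ _ hac).trans (ENNReal.ofReal_le_ofReal ?_)
  rw [Fintype.sum_prod_type, mul_comm, ← nsmul_eq_mul, Nat.card_eq_fintype_card,
    ← Finset.card_univ, ← Finset.sum_const]
  refine Finset.sum_le_sum fun a _ => ?_
  simp only [hprod]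
  change ∑ b, (j a b - p a * q b) ^ 2 / (p a * q b) ≤ ε ^ 2
  rcases (measureReal_nonneg : 0 ≤ p a).eq_or_lt with h0 | h0
  · have h1 : p a = 0 := h0.symm
    simp [h1, sq_nonneg]
  -- `G` is the density of `j a · - p a q` with respect to `q`, the extremal test function against
  -- the indicator `F`: the covariance of `F` and `G` equals the variance `V` of `G`, and the `χ²`
  -- term of `a` is `V / p a`. Where `q b = 0` also `j a b = 0`, so division by zero is harmless.
  let F : β → ℝ := fun x => if x = a then 1 else 0
  let G : γ → ℝ := fun b => (j a b - p a * q b) / q b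
  have hqG : ∀ b, q b * G b = j a b - p a * q b := fun b => by
    by_cases hb : q b = 0
    · have : j a b = 0 := le_antisymm (hb ▸ hjq a b) measureReal_nonneg
      rw [hb, this]; ring
    · exact mul_div_cancel₀ _ hb
  have hpj : p a = ∑ b, j a b := by
    have h1 := (hEX F).symm.trans (hEXY fun x _ => F x)
    rw [Finset.sum_comm] at h1
    simpa [F] using h1
  have hq1 : ∑ b, q b = 1 := by
    have h1 := hEY fun _ => 1
    simpa using h1.symm
  have hG0 : ∫ ω, G (Y ω) ∂μ = 0 := by
    rw [hEY, Finset.sum_congr rfl fun b _ => hqG b, Finset.sum_sub_distrib, ← Finset.mul_sum, hq1,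
      ← hpj]
    ring
  have hF1 : ∫ ω, F (X ω) ∂μ = p a := by
    rw [hEX]; simp [F]
  set V := ∑ b, q b * G b ^ 2 with hV
  have hV0 : 0 ≤ V := Finset.sum_nonneg fun b _ => mul_nonneg measureReal_nonneg (sq_nonneg _)
  have hcov : cov[fun ω => F (X ω), fun ω => G (Y ω); μ] = V := by
    have h1 : ∀ ω, (F (X ω) - p a) * G (Y ω) = F (X ω) * G (Y ω) - p a * G (Y ω) :=
      fun ω => by ring
    rw [covariance, hG0, hF1]
    simp only [sub_zero, h1]
    rw [integral_sub Integrable.of_finite Integrable.of_finite, integral_const_mul,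
      hEXY fun x y => F x * G y, hEY]
    simp only [F, ite_mul, one_mul, zero_mul, mul_ite, mul_zero]
    rw [Finset.sum_comm]
    simp only [Finset.sum_ite_eq', Finset.mem_univ, if_true]
    rw [Finset.mul_sum, ← Finset.sum_sub_distrib]
    refine Finset.sum_congr rfl fun b _ => ?_
    linear_combination (-G b) * hqG b
  have hVG : Var[fun ω => G (Y ω); μ] = V := by
    rw [variance_eq_integral (measurable_of_finite _).aemeasurable, hG0]
    simp only [sub_zero]
    exact hEY fun b => G b ^ 2
  have hVF : Var[fun ω => F (X ω); μ] ≤ p a := by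
    refine (variance_le_expectation_sq (measurable_of_finite _).aestronglyMeasurable).trans ?_
    refine le_of_eq ((hEX fun x => F x ^ 2).trans ?_)
    simp [F]
  have hsum : ∑ b, (j a b - p a * q b) ^ 2 / (p a * q b) = V / p a := by
    rw [hV, Finset.sum_div]
    refine Finset.sum_congr rfl fun b _ => ?_
    by_cases hb : q b = 0
    · simp [hb]
    · rw [← hqG]
      field_simp
  rw [hsum, div_le_iff₀ h0]
  have hmain := h F G
  rw [hcov, hVG] at hmain
  -- As `Var F ≤ p a`, the hypothesis squares to `V² ≤ ε² p a V`; a factor `V` is cancelled when it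
  -- is positive.
  rcases hV0.eq_or_lt with hV1 | hV1
  · rw [← hV1]; positivity
  · have h2 : V ^ 2 ≤ (ε * √(Var[fun ω => F (X ω); μ] * V)) ^ 2 := by gcongr
    rw [mul_pow, Real.sq_sqrt (mul_nonneg (variance_nonneg _ _) hV0)] at h2
    have h3 : V * V ≤ ε ^ 2 * p a * V := by
      calc V * V = V ^ 2 := (sq V).symm
        _ ≤ _ := h2
        _ ≤ ε ^ 2 * (p a * V) := by gcongr
        _ = _ := by ring
    exact le_of_mul_le_mul_right h3 hV1

end MutualInformation

/-! ### Balls in a graph of bounded degree, and the conclusion. -/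

namespace SpinSystem

/-- A finite relaxation time forces `x > 0` and `1 / x ≤ C`. Using `C + 1` keeps the real inverse
meaningful when `C = 0`. -/
theorem le_of_relaxationTime_le {W S : Type*} [Fintype W] [Fintype S] (α : SpinSystem W S)
    (H : SimpleGraph W) {C : ℝ≥0} (h : α.relaxationTime H ≤ C) {x : ℝ}
    (hx : (α.eigenvalueList H)[1]? = some x) : ((C : ℝ) + 1)⁻¹ ≤ x := by
  simp only [relaxationTime, hx] at h
  have h1 : ENNReal.ofReal ((C : ℝ) + 1)⁻¹ ≤ ENNReal.ofReal x := by
    rw [ENNReal.ofReal_inv_of_pos (by positivity), ENNReal.inv_le_iff_inv_le]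
    refine h.trans ?_
    rw [ENNReal.ofReal_add (by positivity) zero_le_one, ENNReal.ofReal_coe_nnreal]
    exact le_self_add
  refine (ENNReal.ofReal_le_ofReal_iff'.1 h1).resolve_right ?_
  have : 0 < ((C : ℝ) + 1)⁻¹ := by positivity
  linarith

end SpinSystem

namespace SimpleGraph

variable {V : Type*} (G : SimpleGraph V) [G.LocallyFinite] (ρ : V) (r : ℕ)

open Classical in
/-- The exponential of the distance to `ρ` has bounded growth on the balls of a graph of bounded
degree. -/
theorem sum_neighborFinset_exp_edist_le {Δ : ℕ} (hΔ : ∀ v, G.degree v ≤ Δ)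
    (v : G.closedBall ρ r) :
    ∑ w ∈ (G.induce (G.closedBall ρ r)).neighborFinset v, Real.exp (G.edist ρ w).toNat
      ≤ (Real.exp 1 * Δ + 1) * Real.exp (G.edist ρ v).toNat := by
  have hv : G.edist ρ v ≠ ⊤ := ne_top_of_le_ne_top (ENat.natCast_ne_top r) v.2
  have h1 : ∀ w ∈ (G.induce (G.closedBall ρ r)).neighborFinset v,
      Real.exp (G.edist ρ w).toNat ≤ Real.exp 1 * Real.exp (G.edist ρ v).toNat := by
    intro w hw
    have hadj : G.Adj v w := by simpa using hw
    rw [← Real.exp_add, Real.exp_le_exp]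
    have h2 : G.edist ρ w ≤ G.edist ρ v + 1 := by
      refine (G.edist_triangle (v := v.1)).trans ?_
      rw [edist_eq_one_iff_adj.2 hadj]
    have h3 := ENat.toNat_le_toNat h2 (by simpa using hv)
    rw [ENat.toNat_add hv (by simp), ENat.toNat_one] at h3
    have h4 : ((G.edist ρ w).toNat : ℝ) ≤ (G.edist ρ v).toNat + 1 := by exact_mod_cast h3
    linarith
  have hcard : ((G.induce (G.closedBall ρ r)).neighborFinset v).card ≤ Δ := by
    refine (Finset.card_le_card_of_injOn Subtype.val (fun w hw => ?_)
      Subtype.val_injective.injOn).trans ((G.card_neighborFinset_eq_degree v).trans_le (hΔ v))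
    simpa using hw
  refine (Finset.sum_le_card_nsmul _ _ _ h1).trans ?_
  rw [nsmul_eq_mul]
  have h5 : (((G.induce (G.closedBall ρ r)).neighborFinset v).card : ℝ) ≤ Δ := by
    exact_mod_cast hcard
  have h6 := Real.exp_pos (G.edist ρ v).toNat
  calc _ ≤ (Δ : ℝ) * (Real.exp 1 * Real.exp (G.edist ρ v).toNat) := by gcongr
    _ ≤ _ := by linarith

end SimpleGraph

theorem eventually_le_exp_mul_nat {c : ℝ} (hc : 0 < c) (K : ℝ) :
    ∀ᶠ r : ℕ in atTop, K ≤ Real.exp (c * r) :=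
  (Real.tendsto_exp_atTop.comp
    (tendsto_natCast_atTop_atTop.const_mul_atTop hc)).eventually_ge_atTop K

theorem SpinSystem.exists_covariance_ballGibbs_le {V S : Type*} [Fintype S] [MeasurableSpace S]
    [DiscreteMeasurableSpace S] (G : SimpleGraph V) [G.LocallyFinite] (Δ : ℕ)
    (hΔ : ∀ v, G.degree v ≤ Δ) (ρ : V) (α : SpinSystem V S)
    (hlegal : ∀ r : ℕ, ∃ σ : G.closedBall ρ r → S, α.ballWeight G ρ r σ ≠ 0)
    (hτ : ∃ C : ℝ≥0, ∀ᶠ r : ℕ in atTop, α.ballRelaxationTime G ρ r ≤ C)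
    (A : Finset V) :
    ∃ c : ℝ, 0 < c ∧ ∀ᶠ r : ℕ in atTop,
      ∀ f g : (G.closedBall ρ r → S) → ℝ,
        DependsOn f {v : G.closedBall ρ r | (v : V) ∈ A} →
        DependsOn g (G.sphereIn ρ r) →
        cov[f, g; α.ballGibbs G ρ r] ≤
          Real.exp (-c * r) * √(Var[f; α.ballGibbs G ρ r] * Var[g; α.ballGibbs G ρ r]) := by
  classical
  obtain ⟨C, hC⟩ := hτ
  set l : ℝ := ((C : ℝ) + 1)⁻¹ with hl
  have hl0 : 0 < l := by positivity
  set D : ℝ := Real.exp 1 * Δ + 1 with hD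
  have hD0 : 0 < D := by positivity
  -- Vertices of `A` outside the component of `ρ` have `toNat ⊤ = 0`; they lie in no ball and only
  -- enlarge this upper bound.
  set F : ℝ := ∑ v ∈ A, Real.exp (G.edist ρ v).toNat with hF
  have hF0 : 0 ≤ F := Finset.sum_nonneg fun _ _ => (Real.exp_pos _).le
  -- Both errors decay at rate at least `2 c`; half of this is given up to absorb the constant `2 F
  -- + exp l` for large `r`.
  set c : ℝ := min (1 / 2) (l / (2 * D)) / 2 with hc
  have hc0 : 0 < c := by positivity
  refine ⟨c, hc0, ?_⟩
  filter_upwards [hC, eventually_le_exp_mul_nat hc0 (2 * F + Real.exp l)] with r hr hK f g hf hg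
  have : Nonempty (G.closedBall ρ r) := ⟨⟨ρ, by simp [SimpleGraph.closedBall]⟩⟩
  set U : Finset (G.closedBall ρ r) := {v | (v : V) ∈ A} with hU
  have hUF : ∑ v ∈ U, Real.exp (G.edist ρ v).toNat ≤ F := by
    refine (Finset.sum_map U (Function.Embedding.subtype _)
      fun v => Real.exp (G.edist ρ v).toNat).symm.trans_le ?_
    refine Finset.sum_le_sum_of_subset_of_nonneg (fun v hv => ?_) fun _ _ _ => (Real.exp_pos _).le
    obtain ⟨w, hw, rfl⟩ := Finset.mem_map.1 hv
    simpa [U] using hw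
  refine ((α.restrict (G.closedBall ρ r)).covariance_gibbs_le (G.induce (G.closedBall ρ r))
    (hlegal r) hl0 (fun x hx => SpinSystem.le_of_relaxationTime_le _ _ hr hx)
    (fun v => Real.exp (G.edist ρ v).toNat) (fun _ => (Real.exp_pos _).le) hD0
    (Nat.cast_nonneg r) (G.sum_neighborFinset_exp_edist_le ρ r hΔ) (G.sphereIn ρ r)
    (fun v hv => ?_) U (by simpa [U] using hf) hg).trans ?_
  · have h1 : G.edist ρ v = r := hv
    rw [h1, ENat.toNat_natCast]
  · refine mul_le_mul_of_nonneg_right ?_ (Real.sqrt_nonneg _)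
    have h1 : Real.exp (-((r : ℝ) / 2)) ≤ Real.exp (-(2 * c * r)) := by
      rw [Real.exp_le_exp, neg_le_neg_iff]
      have : 2 * c ≤ 1 / 2 := by rw [hc, mul_div_cancel₀ _ two_ne_zero]; exact min_le_left _ _
      nlinarith [(Nat.cast_nonneg r : (0 : ℝ) ≤ r)]
    have h2 : Real.exp (-(l * r / (2 * D))) ≤ Real.exp (-(2 * c * r)) := by
      rw [Real.exp_le_exp, neg_le_neg_iff, mul_div_right_comm]
      have : 2 * c ≤ l / (2 * D) := by
        rw [hc, mul_div_cancel₀ _ two_ne_zero]; exact min_le_right _ _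
      gcongr
    calc 2 * (∑ v ∈ U, Real.exp (G.edist ρ v).toNat) * Real.exp (-((r : ℝ) / 2))
          + Real.exp l * Real.exp (-(l * r / (2 * D)))
        ≤ 2 * F * Real.exp (-(2 * c * r)) + Real.exp l * Real.exp (-(2 * c * r)) := by gcongr
      _ = (2 * F + Real.exp l) * Real.exp (-(2 * c * r)) := by ring
      _ ≤ Real.exp (c * r) * Real.exp (-(2 * c * r)) := by gcongr
      _ = Real.exp (-c * r) := by rw [← Real.exp_add]; congr 1; ring

theorem theorem2 {V S : Type*} [Fintype S] [MeasurableSpace S] [DiscreteMeasurableSpace S]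
    (G : SimpleGraph V) [G.LocallyFinite] (Δ : ℕ) (hΔ : ∀ v, G.degree v ≤ Δ) (ρ : V)
    (α : SpinSystem V S)
    (hlegal : ∀ r : ℕ, ∃ σ : G.closedBall ρ r → S, α.ballWeight G ρ r σ ≠ 0)
    (hτ : ∃ C : ℝ≥0, ∀ᶠ r : ℕ in atTop, α.ballRelaxationTime G ρ r ≤ C)
    (A : Finset V) :
    (∃ c : ℝ, 0 < c ∧ ∀ᶠ r : ℕ in atTop,
      ∀ f g : (G.closedBall ρ r → S) → ℝ,
        DependsOn f {v : G.closedBall ρ r | (v : V) ∈ A} →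
        DependsOn g (G.sphereIn ρ r) →
        cov[f, g; α.ballGibbs G ρ r] ≤
          Real.exp (-c * r) * √(Var[f; α.ballGibbs G ρ r] * Var[g; α.ballGibbs G ρ r])) ∧
    (∃ c' : ℝ, 0 < c' ∧ ∀ᶠ r : ℕ in atTop,
      mutualInformation (spinsOn {v : G.closedBall ρ r | (v : V) ∈ A}) (spinsOn (G.sphereIn ρ r))
          (α.ballGibbs G ρ r) ≤
        ENNReal.ofReal (Real.exp (-c' * r))) := by
  have hcov := SpinSystem.exists_covariance_ballGibbs_le G Δ hΔ ρ α hlegal hτ A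
  refine ⟨hcov, ?_⟩
  obtain ⟨c, hc0, hc⟩ := hcov
  -- The same rate works: `ε² = exp (-2 c r)`, and the at most `|S| ^ |A|` values of `σ_A` are
  -- absorbed by `exp (c r)`.
  refine ⟨c, hc0, ?_⟩
  filter_upwards [hc, eventually_le_exp_mul_nat hc0 ((Fintype.card S : ℝ) ^ A.card)] with r hr hK
  have : IsProbabilityMeasure (α.ballGibbs G ρ r) :=
    SpinSystem.isProbabilityMeasure_gibbs _ _ (hlegal r)
  refine (mutualInformation_le_of_covariance_le _ _ _ fun F G' => hr _ _
    (fun σ τ h => ?_) (fun σ τ h => ?_)).trans (ENNReal.ofReal_le_ofReal ?_)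
  · exact congrArg F (funext fun v => h v v.2)
  · exact congrArg G' (funext fun v => h v v.2)
  · have hS : 1 ≤ Fintype.card S := by
      obtain ⟨σ, -⟩ := hlegal r
      exact Fintype.card_pos_iff.2 ⟨σ ⟨ρ, by simp [SimpleGraph.closedBall]⟩⟩
    have hcard : Nat.card {v : G.closedBall ρ r | (v : V) ∈ A} ≤ A.card := by
      rw [← Nat.card_eq_finsetCard]
      exact Nat.card_le_card_of_injective
        (fun v : {v : G.closedBall ρ r | (v : V) ∈ A} => (⟨v.1.1, v.2⟩ : A))
        fun v w h => Subtype.ext (Subtype.ext (congrArg (fun x : A => (x : V)) h))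
    have h1 : (Nat.card ({v : G.closedBall ρ r | (v : V) ∈ A} → S) : ℝ) ≤ Real.exp (c * r) := by
      refine le_trans ?_ hK
      rw [Nat.card_fun, Nat.card_eq_fintype_card (α := S)]
      exact_mod_cast Nat.pow_le_pow_right hS hcard
    calc Real.exp (-c * r) ^ 2 * (Nat.card ({v : G.closedBall ρ r | (v : V) ∈ A} → S) : ℝ)
        ≤ Real.exp (-c * r) ^ 2 * Real.exp (c * r) := by gcongr
      _ = Real.exp (-c * r) := by
        rw [← Real.exp_nat_mul, ← Real.exp_add]; congr 1; push_cast; ring
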